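/- Let $(\Omega,\mathcal F,P)$ be a probability space, $K=\mathbb R$ or $\mathbb C$, and $L^0(\mathcal F,K)$ the algebra of $P$-a.s. equivalence classes of $K$-valued random variables. Let $(X,\|\cdot\|)$ be a complete random normed module over $K$ with base $(\Omega,\mathcal F,P)$: an $L^0(\mathcal F,K)$-module with an $L^0$-norm $\|\cdot\|:X\to L^0_+(\mathcal F)=\{\xi\in L^0(\mathcal F,\mathbb R):\xi\ge 0\}$ satisfying $\|\xi x\|=|\xi|\,\|x\|$, $\|x+y\|\le\|x\|+\|y\|$, and $x=0$ whenever $\|x\|=0$, endowed with the $(\varepsilon,\lambda)$-topology, in which the sets $\{z: P(\|z\|<\varepsilon)>\lambda\}$ ($\varepsilon>0$, $0<\lambda<1$) form a local base at $0$. All limits, derivatives and Riemann integrals below are taken in this topology. Let $B(X)$ be the set of continuous module homomorphisms $X\to X$, with $\|T\|=\bigwedge\{\eta\in L^0_+(\mathcal F): \|Tz\|\le\eta\|z\|\ \forall z\in X\}$. Let $C\in B(X)$ be injective with range $R(C)$, and let $\{V(s):s\ge 0\}\subset B(X)$ be a $C$-semigroup: $s\mapsto V(s)z$ is continuous on $[0,\infty)$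 for every $z\in X$, $V(0)=C$, and $CV(s+t)=V(s)V(t)$ for all $s,t\ge 0$. Suppose that it is locally a.s. bounded, i.e. $\bigvee_{s\in[0,l]}\|V(s)\|\in L^0_+(\mathcal F)$ for every $l>0$. Let $(A,D(A))$ be its generator: $D(A)$ is the set of $z\in X$ such that $\lim_{s\downarrow0}\frac{V(s)z-Cz}{s}$ exists and belongs to $R(C)$, and $Az=C^{-1}\lim_{s\downarrow 0}\frac{V(s)z-Cz}{s}$ for $z\in D(A)$. Then $u\mapsto V(u)z$ is Riemann integrable on $[0,s]$ for all $z\in X$ and $s\ge 0$, and the following hold. 1. $\lim_{s\downarrow 0}\frac1s\int_0^s V(u)z\,du=Cz$ for every $z\in X$. 2. For every $z\in X$ and $s\ge 0$, $\int_0^sV(u)z\,du\in D(A)$ and $A\int_0^sV(u)z\,du=V(s)z-Cz$. 3. $R(C)\subseteq\overline{D(A)}$. 4. For every $z\in D(A)$ and $s\ge 0$, $V(s)z\in D(A)$, the map $r\mapsto V(r)z$ on $[0,\infty)$ is differentiable at $s$ (from the right if $s=0$), and $\frac{d}{ds}V(s)z=V(s)Az=AV(s)z$. 5. For every $z\in D(A)$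 and $s\ge 0$, $\int_0^sV(u)Az\,du=V(s)z-Cz$. 6. $A$ is a closed module homomorphism (its domain $D(A)$ is an $L^0(\mathcal F,K)$-submodule of $X$, $A$ is $L^0(\mathcal F,K)$-linear on it, and its graph is closed in $X\times X$), and $C^{-1}AC=A$, where $C^{-1}AC$ has domain $\{x\in X: Cx\in D(A),\ ACx\in R(C)\}$. -/

import Mathlib

open MeasureTheory Filter Topology Set

/-! ### The algebra `L⁰(𝓕, K)` -/

/-- `L⁰(𝓕, K)`: equivalence classes (modulo `P`-a.s. equality) of `K`-valued random variables. -/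
abbrev L0 {Ω : Type*} {mΩ : MeasurableSpace Ω} (K : Type*) [RCLike K] (P : Measure Ω) : Type _ :=
  Ω →ₘ[P] K

/-- The pointwise ring structure of `L⁰(𝓕, K)`, on top of Mathlib's pointwise addition and
multiplication of classes. -/
noncomputable instance L0.instCommRing {Ω : Type*} {mΩ : MeasurableSpace Ω} {K : Type*} [RCLike K]
    {P : Measure Ω} : CommRing (L0 K P) :=
  { (inferInstance : AddCommGroup (L0 K P)), (inferInstance : CommMonoid (L0 K P)) with
    left_distrib := fun a b c => AEEqFun.toGerm_injective (by
      simp only [AEEqFun.mul_toGerm, AEEqFun.add_toGerm, mul_add])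
    right_distrib := fun a b c => AEEqFun.toGerm_injective (by
      simp only [AEEqFun.mul_toGerm, AEEqFun.add_toGerm, add_mul])
    zero_mul := fun a => AEEqFun.toGerm_injective (by
      simp only [AEEqFun.mul_toGerm, AEEqFun.zero_toGerm, zero_mul])
    mul_zero := fun a => AEEqFun.toGerm_injective (by
      simp only [AEEqFun.mul_toGerm, AEEqFun.zero_toGerm, mul_zero]) }

/-- The modulus `|ξ| ∈ L⁰(𝓕, ℝ)` of `ξ ∈ L⁰(𝓕, K)`. -/
noncomputable def L0.modulus {Ω : Type*} {mΩ : MeasurableSpace Ω} {K : Type*} [RCLike K]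
    {P : Measure Ω} (ξ : L0 K P) : L0 ℝ P :=
  AEEqFun.comp (fun k : K => ‖k‖) continuous_norm ξ

/-! ### Random normed modules and the `(ε, λ)`-topology -/

/-- A random normed module (`RN` module) over `K` with base `(Ω, 𝓕, P)`: an `L⁰(𝓕, K)`-module `X`
with an `L⁰`-norm `X → L⁰₊(𝓕)`. -/
class RNModule {Ω : outParam (Type*)} {mΩ : outParam (MeasurableSpace Ω)} (K : outParam (Type*))
    [RCLike K] (P : outParam (Measure Ω)) (X : Type*) [AddCommGroup X] [Module (L0 K P) X] where
  /-- The `L⁰`-norm. -/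
  rnorm : X → L0 ℝ P
  rnorm_nonneg : ∀ x, 0 ≤ rnorm x
  rnorm_smul : ∀ (ξ : L0 K P) (x : X), rnorm (ξ • x) = L0.modulus ξ * rnorm x
  rnorm_add_le : ∀ x y, rnorm (x + y) ≤ rnorm x + rnorm y
  eq_zero_of_rnorm : ∀ x, rnorm x = 0 → x = 0

namespace RNModule

section Basic

variable {Ω : Type*} {mΩ : MeasurableSpace Ω} {K : Type*} [RCLike K] {P : Measure Ω}
  {X : Type*} [AddCommGroup X] [Module (L0 K P) X] [RNModule K P X]

/-- `U_θ(ε, λ) = {z | P {ω | ‖z‖(ω) < ε} > λ}`. -/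
def epsLamBall (X : Type*) [AddCommGroup X] [Module (L0 K P) X] [RNModule K P X] (ε lam : ℝ) :
    Set X :=
  {z : X | lam < P.real {ω | rnorm z ω < ε}}

theorem rnorm_zero : rnorm (0 : X) = 0 := by
  have h := rnorm_smul (0 : L0 K P) (0 : X)
  have h0 : L0.modulus (0 : L0 K P) = 0 := by
    apply AEEqFun.toGerm_injective
    unfold L0.modulus
    rw [AEEqFun.comp_toGerm, AEEqFun.zero_toGerm, AEEqFun.zero_toGerm]
    change ((fun ω : Ω => ‖(0 : K)‖ : Ω → ℝ) : Germ (ae P) ℝ) = ((0 : Ω → ℝ) : Germ (ae P) ℝ)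
    congr 1
    funext ω
    simp
  rw [smul_zero, h0, zero_mul] at h
  exact h

theorem rnorm_neg (x : X) : rnorm (-x) = rnorm x := by
  have h := rnorm_smul (-1 : L0 K P) x
  have h0 : L0.modulus (-1 : L0 K P) = 1 := by
    apply AEEqFun.toGerm_injective
    unfold L0.modulus
    rw [AEEqFun.comp_toGerm, AEEqFun.neg_toGerm, AEEqFun.one_toGerm, AEEqFun.one_toGerm]
    change ((fun ω : Ω => ‖-(1 : K)‖ : Ω → ℝ) : Germ (ae P) ℝ) = ((1 : Ω → ℝ) : Germ (ae P) ℝ)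
    congr 1
    funext ω
    simp
  rw [neg_smul, one_smul, h0, one_mul] at h
  exact h

variable [IsProbabilityMeasure P]

theorem add_mem_epsLamBall {ε lam : ℝ} {x y : X} (hx : x ∈ epsLamBall X (ε / 2) ((1 + lam) / 2))
    (hy : y ∈ epsLamBall X (ε / 2) ((1 + lam) / 2)) : x + y ∈ epsLamBall X ε lam := by
  have hm : ∀ z : X, ∀ δ : ℝ, MeasurableSet {ω | rnorm z ω < δ} := fun z δ =>
    (AEEqFun.measurable (rnorm z)) measurableSet_Iio
  have key : P.real ({ω | rnorm x ω < ε / 2} ∩ {ω | rnorm y ω < ε / 2})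
      ≤ P.real {ω | rnorm (x + y) ω < ε} := by
    apply ENNReal.toReal_mono (measure_ne_top _ _)
    apply measure_mono_ae
    have h1 := (AEEqFun.coeFn_le).2 (rnorm_add_le x y)
    filter_upwards [h1, AEEqFun.coeFn_add (rnorm x) (rnorm y)] with ω h2 h3 h4
    have h5 : rnorm x ω < ε / 2 := h4.1
    have h6 : rnorm y ω < ε / 2 := h4.2
    rw [h3, Pi.add_apply] at h2
    change rnorm (x + y) ω < ε
    linarith
  have hu := measureReal_union_add_inter (μ := P) (s := {ω | rnorm x ω < ε / 2}) (hm y (ε / 2))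
  have h1 : P.real ({ω | rnorm x ω < ε / 2} ∪ {ω | rnorm y ω < ε / 2}) ≤ 1 :=
    measureReal_le_one
  change (1 + lam) / 2 < P.real {ω | rnorm x ω < ε / 2} at hx
  change (1 + lam) / 2 < P.real {ω | rnorm y ω < ε / 2} at hy
  change lam < P.real {ω | rnorm (x + y) ω < ε}
  linarith

/-- The sets `U_θ(ε, λ)`, `ε > 0`, `0 < λ < 1`, form a basis at `θ` for a group topology. -/
abbrev epsLamBasis (X : Type*) [AddCommGroup X] [Module (L0 K P) X] [RNModule K P X] :
    AddGroupFilterBasis X :=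
  addGroupFilterBasisOfComm {U : Set X | ∃ ε lam : ℝ, 0 < ε ∧ 0 < lam ∧ lam < 1 ∧
      U = epsLamBall X ε lam}
    ⟨_, 1, 1 / 2, by norm_num, by norm_num, by norm_num, rfl⟩
    (by
      rintro _ _ ⟨ε, l, hε, hl, hl', rfl⟩ ⟨ε', l', hε', hk, hk', rfl⟩
      refine ⟨_, ⟨min ε ε', max l l', lt_min hε hε', lt_max_of_lt_left hl, max_lt hl' hk', rfl⟩, ?_⟩
      intro z hz
      have hz' : max l l' < P.real {ω | rnorm z ω < min ε ε'} := hz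
      constructor
      · refine lt_of_lt_of_le (lt_of_le_of_lt (le_max_left _ _) hz') ?_
        exact measureReal_mono (fun ω (hω : rnorm z ω < min ε ε') =>
          lt_of_lt_of_le hω (min_le_left _ _))
      · refine lt_of_lt_of_le (lt_of_le_of_lt (le_max_right _ _) hz') ?_
        exact measureReal_mono (fun ω (hω : rnorm z ω < min ε ε') =>
          lt_of_lt_of_le hω (min_le_right _ _)))
    (by
      rintro _ ⟨ε, l, hε, hl, hl', rfl⟩
      have h : P.real {ω | rnorm (0 : X) ω < ε} = 1 := by
        have h1 : {ω | rnorm (0 : X) ω < ε} =ᵐ[P] (univ : Set Ω) := by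
          rw [rnorm_zero]
          filter_upwards [AEEqFun.coeFn_zero (β := ℝ) (μ := P)] with ω h2
          apply propext
          change (0 : L0 ℝ P) ω < ε ↔ True
          rw [h2]
          simpa using hε
        rw [measureReal_congr h1]
        exact probReal_univ
      change l < P.real {ω | rnorm (0 : X) ω < ε}
      rw [h]
      exact hl')
    (by
      rintro _ ⟨ε, l, hε, hl, hl', rfl⟩
      refine ⟨_, ⟨ε / 2, (1 + l) / 2, by linarith, by linarith, by linarith, rfl⟩, ?_⟩
      rintro _ ⟨x, hx, y, hy, rfl⟩
      exact add_mem_epsLamBall hx hy)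
    (by
      rintro _ ⟨ε, l, hε, hl, hl', rfl⟩
      refine ⟨_, ⟨ε, l, hε, hl, hl', rfl⟩, ?_⟩
      intro x hx
      change l < P.real {ω | rnorm (-x) ω < ε}
      rw [rnorm_neg]
      exact hx)

/-- Every `RN` module carries the `(ε, λ)`-topology, with its translation-invariant uniformity.
A sequence converges to `z` iff `‖zₙ - z‖ → 0` in probability. -/
instance instUniformSpace : UniformSpace X := (epsLamBasis X).uniformSpace

end Basic

/-! ### Calculus in `RN` modules -/

section Calculus

variable {Ω : Type*} {mΩ : MeasurableSpace Ω} (K : Type*) [RCLike K] (P : Measure Ω)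
  {X : Type*} [AddCommGroup X] [Module (L0 K P) X] [RNModule K P X]

/-- Multiplication of a vector by a real number, seen as a constant element of `L⁰(𝓕, K)`. -/
noncomputable def rsmul (r : ℝ) (x : X) : X :=
  (AEEqFun.const Ω (r : K) : L0 K P) • x

end Calculus

/-- Tagged partitions `a = t₀ ≤ t₁ ≤ ⋯ ≤ tₙ = b` of `[a, b]`, with tags `tᵢ ≤ ξᵢ ≤ tᵢ₊₁`. -/
structure TaggedPartition (a b : ℝ) where
  n : ℕ
  pt : ℕ → ℝ
  tag : ℕ → ℝ
  pt_zero : pt 0 = a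
  pt_last : pt n = b
  pt_le : ∀ i < n, pt i ≤ pt (i + 1)
  tag_mem : ∀ i < n, tag i ∈ Icc (pt i) (pt (i + 1))

section Calculus

variable {Ω : Type*} {mΩ : MeasurableSpace Ω} (K : Type*) [RCLike K] (P : Measure Ω)
  {X : Type*} [AddCommGroup X] [Module (L0 K P) X] [RNModule K P X]

/-- The Riemann sum of `f` over a tagged partition. -/
noncomputable def riemannSum (f : ℝ → X) {a b : ℝ} (π : TaggedPartition a b) : X :=
  ∑ i ∈ Finset.range π.n, rsmul K P (π.pt (i + 1) - π.pt i) (f (π.tag i))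

variable [IsProbabilityMeasure P]

/-- For `a ≤ b`: the Riemann sums of `f` over `[a, b]` converge to `I` in the `(ε, λ)`-topology as
the mesh tends to `0`. -/
def HasRiemannIntegral (f : ℝ → X) (a b : ℝ) (I : X) : Prop :=
  ∀ U ∈ 𝓝 I, ∃ δ > 0, ∀ π : TaggedPartition a b,
    (∀ i < π.n, π.pt (i + 1) - π.pt i < δ) → riemannSum K P f π ∈ U

/-- `f` is Riemann integrable on `[a, b]`. -/
def RiemannIntegrable (f : ℝ → X) (a b : ℝ) : Prop :=
  ∃ I : X, HasRiemannIntegral K P f a b I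

open Classical in
/-- The Riemann integral of `f` on `[a, b]` (`0` if `f` is not Riemann integrable there). -/
noncomputable def riemannIntegral (f : ℝ → X) (a b : ℝ) : X :=
  if h : RiemannIntegrable K P f a b then h.choose else 0

/-- The function `f`, considered on `[0, ∞)`, has derivative `y` at `s ≥ 0` (one-sided if
`s = 0`). -/
def HasDerivOnHalfLine (f : ℝ → X) (y : X) (s : ℝ) : Prop :=
  Tendsto (fun r : ℝ => rsmul K P (r - s)⁻¹ (f r - f s)) (𝓝[Ici 0 \ {s}] s) (𝓝 y)

end Calculus

/-! ### `C`-semigroups -/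

section Semigroup

variable {Ω : Type*} {mΩ : MeasurableSpace Ω} {K : Type*} [RCLike K] {P : Measure Ω}
  [IsProbabilityMeasure P]
  {X : Type*} [AddCommGroup X] [Module (L0 K P) X] [RNModule K P X]

/-- `ν = ‖T‖`, where `‖T‖ = ⋀ {η ∈ L⁰₊ | ∀ z, ‖T z‖ ≤ η ‖z‖}`; here `T` is a continuous module
homomorphism. -/
def IsOpNorm (T : X →L[L0 K P] X) (ν : L0 ℝ P) : Prop :=
  IsGLB {η : L0 ℝ P | 0 ≤ η ∧ ∀ z : X, rnorm (T z) ≤ η * rnorm z} ν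

/-- The family `{V(s) : s ≥ 0}` is locally a.s. bounded: for every `l > 0`, the supremum
`⋁_{s ∈ [0, l]} ‖V(s)‖` belongs to `L⁰₊(𝓕)`. -/
def LocallyASBounded (V : ℝ → X →L[L0 K P] X) : Prop :=
  ∀ l : ℝ, 0 < l → ∃ ν : ℝ → L0 ℝ P, (∀ s ∈ Icc 0 l, IsOpNorm (V s) (ν s)) ∧
    ∃ ξ : L0 ℝ P, 0 ≤ ξ ∧ IsLUB (ν '' Icc 0 l) ξ

/-- `{V(s) : s ≥ 0}` is a `C`-semigroup of continuous module homomorphisms on `X`. The values of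
`V` at negative numbers play no role. -/
structure IsCSemigroup (C : X →L[L0 K P] X) (V : ℝ → X →L[L0 K P] X) : Prop where
  injective : Function.Injective C
  strongly_continuous : ∀ z : X, ContinuousOn (fun s => V s z) (Ici 0)
  map_zero : V 0 = C
  mul : ∀ s t : ℝ, 0 ≤ s → 0 ≤ t → ∀ z : X, C (V (s + t) z) = V s (V t z)

/-- For an injective `C`: the inverse `C⁻¹`, a partial function with domain `R(C)`. -/
noncomputable def cInv (C : X →L[L0 K P] X) : X →. X := fun y =>
  ⟨y ∈ range C, fun h => h.choose⟩

/-- The partial function `z ↦ lim_{s ↓ 0} (V(s) z - C z) / s`, defined where the limit exists. -/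
noncomputable def rightLimitQuotient (C : X →L[L0 K P] X) (V : ℝ → X →L[L0 K P] X) : X →. X :=
  fun z => ⟨∃ y : X, Tendsto (fun s : ℝ => rsmul K P s⁻¹ (V s z - C z)) (𝓝[>] 0) (𝓝 y),
    fun h => h.choose⟩

/-- The generator `A z = C⁻¹ lim_{s ↓ 0} (V(s) z - C z) / s`, a partial function whose domain
`D(A) = (generator C V).Dom` consists of the `z` for which the limit exists and lies in `R(C)`. -/
noncomputable def generator (C : X →L[L0 K P] X) (V : ℝ → X →L[L0 K P] X) : X →. X :=
  (cInv C).comp (rightLimitQuotient C V)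

end Semigroup

/-- The partial function `A` is a module homomorphism: `D(A)` is an `L⁰(𝓕, K)`-submodule of `X`
and `A` is `L⁰(𝓕, K)`-linear on it. -/
def IsModuleHom {Ω : Type*} {mΩ : MeasurableSpace Ω} (K : Type*) [RCLike K] (P : Measure Ω)
    {X : Type*} [AddCommGroup X] [Module (L0 K P) X] (A : X →. X) : Prop :=
  ∃ T : X →ₗ.[L0 K P] X, (T.graph : Set (X × X)) = A.graph

end RNModule

/-! A continuous curve in a complete random normed module need not be Riemann integrable, and this
is where local a.s. boundedness enters. If `‖f(s)‖ ≤ η` on `[0, l]`, multiply by the unit `v = (1 +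
|η|)⁻¹` of `L⁰`. The curve `v • f` has `L⁰`-norm at most `1`, so it takes values in the vectors with
integrable `L⁰`-norm, and bounded convergence makes it continuous for the norm `E‖x‖`. As `X` is
complete, the inclusion of these vectors extends continuously to their Banach completion; following
it by `v⁻¹` recovers `f` (`exists_continuous_lift`). Integrability, translation of the variable and
the fundamental theorem of calculus are thus inherited from Banach-valued integrals.

Write `J_s z = ∫₀ˢ V(u) z du`. It is a continuous module homomorphism commuting with `C` and every
`V(h)`, and difference quotients give `A J_s z = V(s) z - C z`
(`sub_mem_generator_semigroupIntegral`). Hence `y = A z` iff `J_s y = V(s) z - C z` for all `s ≥ 0`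
(`mem_generator_iff_integral`). This family of continuous linear equations yields linearity,
closedness, the derivative formula and `C⁻¹AC = A`. -/

namespace L0

/-! ### Almost-sure estimates in `L⁰`. -/

variable {Ω : Type*} {mΩ : MeasurableSpace Ω} {K : Type*} [RCLike K] {P : Measure Ω}

theorem coeFn_modulus (ξ : L0 K P) : L0.modulus ξ =ᵐ[P] fun ω => ‖ξ ω‖ :=
  AEEqFun.coeFn_comp _ _ _

theorem modulus_nonneg (ξ : L0 K P) : 0 ≤ L0.modulus ξ := by
  rw [← AEEqFun.coeFn_le]
  filter_upwards [coeFn_modulus ξ, AEEqFun.coeFn_zero (β := ℝ) (μ := P)] with ω h h0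
  rw [h, h0]
  exact norm_nonneg _

theorem coeFn_le_mul {a η b : L0 ℝ P} (h : a ≤ η * b) : ∀ᵐ ω ∂P, a ω ≤ η ω * b ω := by
  filter_upwards [AEEqFun.coeFn_le.2 h, AEEqFun.coeFn_mul η b] with ω h1 h2
  rwa [h2] at h1

theorem coeFn_nonneg {a : L0 ℝ P} (h : 0 ≤ a) : ∀ᵐ ω ∂P, 0 ≤ a ω := by
  filter_upwards [AEEqFun.coeFn_le.2 h, AEEqFun.coeFn_zero (β := ℝ) (μ := P)] with ω h1 h2
  rwa [h2] at h1

theorem measurableSet_ge (a : L0 ℝ P) (ε : ℝ) : MeasurableSet {ω | ε ≤ a ω} :=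
  (AEEqFun.measurable a) measurableSet_Ici

variable (K P) in
/-- The embedding of `ℝ` into `L⁰(𝓕, K)` as constants. -/
noncomputable def realConst : ℝ →+* L0 K P where
  toFun r := AEEqFun.const Ω (r : K)
  map_one' := by
    rw [RCLike.ofReal_one]
    rfl
  map_zero' := by
    rw [RCLike.ofReal_zero]
    rfl
  map_mul' r s := by
    apply AEEqFun.ext
    filter_upwards [AEEqFun.coeFn_const (μ := P) Ω ((r * s : ℝ) : K),
      AEEqFun.coeFn_const (μ := P) Ω (r : K), AEEqFun.coeFn_const (μ := P) Ω (s : K),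
      AEEqFun.coeFn_mul (AEEqFun.const Ω (r : K) : L0 K P) (AEEqFun.const Ω (s : K))]
      with ω h1 h2 h3 h4
    rw [h1, h4, Pi.mul_apply, h2, h3]
    simp
  map_add' r s := by
    apply AEEqFun.ext
    filter_upwards [AEEqFun.coeFn_const (μ := P) Ω ((r + s : ℝ) : K),
      AEEqFun.coeFn_const (μ := P) Ω (r : K), AEEqFun.coeFn_const (μ := P) Ω (s : K),
      AEEqFun.coeFn_add (AEEqFun.const Ω (r : K) : L0 K P) (AEEqFun.const Ω (s : K))]
      with ω h1 h2 h3 h4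
    rw [h1, h4, Pi.add_apply, h2, h3]
    simp

theorem coeFn_realConst (r : ℝ) : ∀ᵐ ω ∂P, realConst K P r ω = (r : K) :=
  AEEqFun.coeFn_const (μ := P) Ω (r : K)

variable [IsProbabilityMeasure P]

/-- Tightness of a single random variable: the sets `{n ≤ η}` decrease to the empty set because `η`
is finite. -/
theorem exists_measureReal_ge_lt (η : L0 ℝ P) {ε : ℝ} (hε : 0 < ε) :
    ∃ M : ℝ, 0 < M ∧ P.real {ω | M ≤ η ω} < ε := by
  have h := tendsto_measure_iInter_atTop (μ := P) (s := fun n : ℕ => {ω | (n : ℝ) ≤ η ω})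
    (fun n => (measurableSet_ge η n).nullMeasurableSet)
    (fun m n hmn ω (hω : (n : ℝ) ≤ η ω) => le_trans (Nat.cast_le.2 hmn) hω)
    ⟨0, measure_ne_top _ _⟩
  have h0 : (⋂ n : ℕ, {ω | (n : ℝ) ≤ η ω}) = ∅ := by
    rw [eq_empty_iff_forall_notMem]
    intro ω hω
    obtain ⟨n, hn⟩ := exists_nat_gt (η ω)
    exact absurd (mem_iInter.1 hω n) (not_le.2 hn)
  rw [h0, measure_empty] at h
  have h1 := (ENNReal.tendsto_toReal ENNReal.zero_ne_top).comp h
  obtain ⟨n, hn, hn'⟩ := ((h1.eventually (gt_mem_nhds hε)).and (eventually_gt_atTop 0)).exists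
  exact ⟨n, Nat.cast_pos.2 hn', hn⟩

/-- Multiplication by a fixed `η` is continuous in probability. -/
theorem exists_measureReal_lt_of_le_mul (η : L0 ℝ P) {ε : ℝ} (hε : 0 < ε) :
    ∃ δ > 0, ∀ a b : L0 ℝ P, 0 ≤ b → a ≤ η * b → P.real {ω | δ ≤ b ω} < δ →
      P.real {ω | ε ≤ a ω} < ε := by
  obtain ⟨M, hM, hMη⟩ := exists_measureReal_ge_lt η (half_pos hε)
  -- Where `η < M` and `b < ε / M` the product stays below `ε`; each of the two exceptional sets has
  -- probability at most `ε / 2`.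
  refine ⟨min (ε / 2) (ε / M), lt_min (half_pos hε) (div_pos hε hM), fun a b hb hab hδ => ?_⟩
  have h1 : P.real {ω | ε ≤ a ω} ≤
      P.real ({ω | M ≤ η ω} ∪ {ω | min (ε / 2) (ε / M) ≤ b ω}) := by
    apply ENNReal.toReal_mono (measure_ne_top _ _)
    apply measure_mono_ae
    filter_upwards [coeFn_le_mul hab, coeFn_nonneg hb] with ω h2 h3 h4
    have h4 : ε ≤ a ω := h4
    by_contra h5
    have h6 : η ω < M := not_le.1 fun h => h5 (Or.inl h)
    have h7 : b ω < min (ε / 2) (ε / M) := not_le.1 fun h => h5 (Or.inr h)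
    have h8 : M * b ω < ε := by
      have := lt_of_lt_of_le h7 (min_le_right _ _)
      rwa [lt_div_iff₀ hM, mul_comm] at this
    nlinarith
  have h2 := measureReal_union_le (μ := P) {ω | M ≤ η ω} {ω | min (ε / 2) (ε / M) ≤ b ω}
  have h3 := min_le_left (ε / 2) (ε / M)
  linarith

end L0

/-! ### The `(ε, λ)`-topology. -/

namespace RNModule

variable {Ω : Type*} {mΩ : MeasurableSpace Ω} {K : Type*} [RCLike K] {P : Measure Ω}
  {X : Type*} [AddCommGroup X] [Module (L0 K P) X]

theorem rsmul_eq (r : ℝ) (x : X) : rsmul K P r x = L0.realConst K P r • x := rfl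

theorem map_rsmul (T : X →ₗ[L0 K P] X) (r : ℝ) (x : X) :
    T (rsmul K P r x) = rsmul K P r (T x) := T.map_smul _ _

theorem rsmul_smul (r : ℝ) (ξ : L0 K P) (x : X) :
    ξ • rsmul K P r x = rsmul K P r (ξ • x) := smul_comm _ _ _

variable [RNModule K P X]

theorem rnorm_rsmul (r : ℝ) (x : X) : ∀ᵐ ω ∂P, rnorm (rsmul K P r x) ω = |r| * rnorm x ω := by
  rw [rsmul_eq, rnorm_smul]
  filter_upwards [AEEqFun.coeFn_mul (L0.modulus (L0.realConst K P r)) (rnorm x),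
    L0.coeFn_modulus (L0.realConst K P r), L0.coeFn_realConst (K := K) (P := P) r] with ω h1 h2 h3
  rw [h1, Pi.mul_apply, h2, h3, RCLike.norm_ofReal]

variable [IsProbabilityMeasure P]

instance instIsUniformAddGroup : IsUniformAddGroup X := (epsLamBasis X).isUniformAddGroup

/-- One parameter suffices: convergence in probability may use the same `ε` for the size of the
deviation and for its probability. -/
theorem mem_nhds_zero {U : Set X} :
    U ∈ 𝓝 (0 : X) ↔ ∃ ε > 0, ∀ x : X, P.real {ω | ε ≤ rnorm x ω} < ε → x ∈ U := by
  have hb : ∀ (ε l : ℝ) (x : X),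
      x ∈ epsLamBall X ε l ↔ P.real {ω | ε ≤ rnorm x ω} < 1 - l := by
    intro ε l x
    have h1 : {ω | rnorm x ω < ε} = {ω | ε ≤ rnorm x ω}ᶜ := by
      ext ω
      simp
    change l < P.real {ω | rnorm x ω < ε} ↔ _
    rw [h1, probReal_compl_eq_one_sub (L0.measurableSet_ge _ _)]
    constructor <;> intro h <;> linarith
  have h := (epsLamBasis X).nhds_zero_hasBasis.mem_iff (t := U)
  refine Iff.trans h ⟨?_, ?_⟩
  · rintro ⟨_, ⟨ε, l, hε, hl, hl', rfl⟩, hU⟩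
    refine ⟨min ε (1 - l), lt_min hε (by linarith), fun x hx => hU ((hb ε l x).2 ?_)⟩
    refine lt_of_le_of_lt ?_ (lt_of_lt_of_le hx (min_le_right _ _))
    exact measureReal_mono fun ω (hω : ε ≤ rnorm x ω) => le_trans (min_le_left _ _) hω
  · rintro ⟨ε, hε, hU⟩
    have h2 : 0 < min ε (1 / 2) := lt_min hε (by norm_num)
    have h3 : min ε (1 / 2) ≤ 1 / 2 := min_le_right _ _
    -- The cap `1 / 2` keeps `λ` strictly between `0` and `1`.
    refine ⟨_, ⟨ε, 1 - min ε (1 / 2), hε, by linarith, by linarith, rfl⟩, fun x hx => hU x ?_⟩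
    have h4 := (hb _ _ x).1 hx
    have h5 : min ε (1 / 2) ≤ ε := min_le_left _ _
    linarith

theorem mem_nhds {U : Set X} {x : X} :
    U ∈ 𝓝 x ↔ ∃ ε > 0, ∀ y : X, P.real {ω | ε ≤ rnorm (y - x) ω} < ε → y ∈ U := by
  rw [← map_add_left_nhds_zero x, mem_map, mem_nhds_zero]
  refine exists_congr fun ε => and_congr_right fun _ => ⟨fun h y hy => ?_, fun h y hy => ?_⟩
  · simpa using h (y - x) hy
  · exact h (x + y) (by simpa using hy)

theorem eventually_nhds_measureReal_lt (x : X) {ε : ℝ} (hε : 0 < ε) :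
    ∀ᶠ y in 𝓝 x, P.real {ω | ε ≤ rnorm (y - x) ω} < ε :=
  mem_nhds.2 ⟨ε, hε, fun _ h => h⟩

/-- The order intervals of the `L⁰`-norm are closed. -/
theorem isClosed_rnorm_le (η : L0 ℝ P) : IsClosed {x : X | rnorm x ≤ η} := by
  rw [← isOpen_compl_iff, isOpen_iff_mem_nhds]
  intro x hx
  by_contra hU
  apply hx
  have key : ∀ ε : ℝ, 0 < ε → P.real {ω | η ω + ε ≤ rnorm x ω} < ε := by
    intro ε hε
    by_contra h
    apply hU
    rw [mem_nhds]
    refine ⟨ε, hε, fun y hy hy' => h (lt_of_le_of_lt ?_ hy)⟩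
    apply ENNReal.toReal_mono (measure_ne_top _ _)
    apply measure_mono_ae
    have h1 : rnorm x ≤ rnorm (y - x) + rnorm y := by
      have := rnorm_add_le (-(y - x)) y
      rwa [rnorm_neg, neg_sub, sub_add_cancel] at this
    filter_upwards [AEEqFun.coeFn_le.2 h1, AEEqFun.coeFn_add (rnorm (y - x)) (rnorm y),
      AEEqFun.coeFn_le.2 (show rnorm y ≤ η from hy')] with ω h2 h3 h4 h5
    have h5 : η ω + ε ≤ rnorm x ω := h5
    rw [h3, Pi.add_apply] at h2
    change ε ≤ rnorm (y - x) ω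
    linarith
  have h2 : ∀ n : ℕ, P {ω | η ω + 1 / (n + 1 : ℝ) ≤ rnorm x ω} = 0 := by
    intro n
    have h3 : P.real {ω | η ω + 1 / (n + 1 : ℝ) ≤ rnorm x ω} ≤ 0 := by
      refine le_of_forall_pos_le_add fun ε hε => ?_
      rw [zero_add]
      -- The minimum decouples the two roles of `ε`: the excess `1 / (n + 1)` is fixed while the
      -- probability bound tends to `0`.
      refine le_trans ?_ ((key (min ε (1 / (n + 1))) (lt_min hε (by positivity))).le.trans
        (min_le_left _ _))
      exact measureReal_mono fun ω (hω : η ω + 1 / (n + 1 : ℝ) ≤ rnorm x ω) =>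
        le_trans (by gcongr; exact min_le_right _ _) hω
    exact (measureReal_eq_zero_iff).1 (le_antisymm h3 measureReal_nonneg)
  change rnorm x ≤ η
  rw [← AEEqFun.coeFn_le]
  have h3 : ∀ᵐ ω ∂P, ∀ n : ℕ, ¬ (η ω + 1 / (n + 1 : ℝ) ≤ rnorm x ω) :=
    ae_all_iff.2 fun n => by
      rw [ae_iff]
      simpa using h2 n
  filter_upwards [h3] with ω h4
  by_contra h5
  obtain ⟨n, hn⟩ := exists_nat_one_div_lt (sub_pos.2 (not_le.1 h5))
  exact h4 n (by linarith)

instance instT2Space : T2Space X := by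
  have h : IsClosed ({0} : Set X) := by
    convert isClosed_rnorm_le (X := X) (0 : L0 ℝ P) using 1
    ext x
    constructor
    · rintro rfl
      exact rnorm_zero.le
    · exact fun h => eq_zero_of_rnorm x (le_antisymm h (rnorm_nonneg x))
  have := IsTopologicalAddGroup.t1Space X h
  apply IsTopologicalAddGroup.t2Space_of_zero_sep
  exact fun x hx => ⟨{x}ᶜ, isOpen_compl_singleton.mem_nhds (Ne.symm hx), fun h => h rfl⟩

/-- An additive map dominated by the `L⁰`-norm is continuous. -/
theorem continuous_of_rnorm_le (T : X →+ X) (η : L0 ℝ P)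
    (hT : ∀ x, rnorm (T x) ≤ η * rnorm x) : Continuous T := by
  apply continuous_of_continuousAt_zero
  intro U hU
  rw [map_zero] at hU
  obtain ⟨ε, hε, hU⟩ := mem_nhds_zero.1 hU
  obtain ⟨δ, hδ, h⟩ := L0.exists_measureReal_lt_of_le_mul η hε
  exact mem_nhds_zero.2 ⟨δ, hδ, fun x hx => hU _ (h _ _ (rnorm_nonneg x) (hT x) hx)⟩

instance instContinuousConstSMul : ContinuousConstSMul (L0 K P) X where
  continuous_const_smul ξ := continuous_of_rnorm_le (DistribSMul.toAddMonoidHom X ξ)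
    (L0.modulus ξ) fun x => (rnorm_smul ξ x).le

theorem continuous_rsmul (r : ℝ) : Continuous (rsmul K P r : X → X) :=
  continuous_const_smul (L0.realConst K P r)

end RNModule

/-! ### The Banach space generated by the integrable vectors. -/

namespace RNModule

section Integrable

variable {Ω : Type*} {mΩ : MeasurableSpace Ω} {K : Type*} [RCLike K] {P : Measure Ω}
  (X : Type*) [AddCommGroup X] [Module (L0 K P) X] [RNModule K P X]

/-- The vectors whose `L⁰`-norm is integrable. -/
def integrableVectors : AddSubgroup X where
  carrier := {x | Integrable (rnorm x) P}
  zero_mem' := by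
    change Integrable (rnorm (0 : X)) P
    rw [rnorm_zero]
    exact (integrable_zero Ω ℝ P).congr AEEqFun.coeFn_zero.symm
  add_mem' {x y} hx hy := by
    refine Integrable.mono' (Integrable.add hx hy) (AEEqFun.aestronglyMeasurable _) ?_
    filter_upwards [AEEqFun.coeFn_le.2 (rnorm_add_le x y), AEEqFun.coeFn_add (rnorm x) (rnorm y),
      L0.coeFn_nonneg (rnorm_nonneg (x + y))] with ω h1 h2 h3
    rw [h2] at h1
    rwa [Real.norm_of_nonneg h3]
  neg_mem' {x} hx := by
    change Integrable (rnorm (-x)) P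
    rw [rnorm_neg]
    exact hx

/-- The integrable vectors as a type, to carry the norm `x ↦ E‖x‖`. -/
def L1Part : Type _ := integrableVectors X

noncomputable instance : AddCommGroup (L1Part X) :=
  inferInstanceAs (AddCommGroup (integrableVectors X))

variable {X}

theorem integrable_rsmul {x : X} (hx : Integrable (rnorm x) P) (r : ℝ) :
    Integrable (rnorm (rsmul K P r x)) P :=
  (hx.const_mul |r|).congr <| (rnorm_rsmul r x).mono fun _ h => h.symm

noncomputable instance : Module ℝ (L1Part X) where
  smul r x := ⟨rsmul K P r x.1, integrable_rsmul x.2 r⟩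
  one_smul x := Subtype.ext <| show L0.realConst K P 1 • x.1 = x.1 by rw [map_one, one_smul]
  mul_smul r s x := Subtype.ext <|
    show L0.realConst K P (r * s) • x.1 = L0.realConst K P r • L0.realConst K P s • x.1 by
      rw [map_mul, mul_smul]
  smul_zero r := Subtype.ext <| smul_zero (L0.realConst K P r)
  smul_add r x y := Subtype.ext <| smul_add (L0.realConst K P r) x.1 y.1
  add_smul r s x := Subtype.ext <|
    show L0.realConst K P (r + s) • x.1 = L0.realConst K P r • x.1 + L0.realConst K P s • x.1 by
      rw [map_add, add_smul]
  zero_smul x := Subtype.ext <| show L0.realConst K P 0 • x.1 = 0 by rw [map_zero, zero_smul]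

noncomputable instance : NormedAddCommGroup (L1Part X) :=
  AddGroupNorm.toNormedAddCommGroup
    { toFun := fun x => ∫ ω, rnorm x.1 ω ∂P
      map_zero' := by
        change ∫ ω, rnorm (0 : X) ω ∂P = 0
        rw [rnorm_zero, integral_congr_ae AEEqFun.coeFn_zero]
        simp
      add_le' := fun x y => by
        rw [← integral_add x.2 y.2]
        refine integral_mono_ae (x + y).2 (Integrable.add x.2 y.2) ?_
        filter_upwards [AEEqFun.coeFn_le.2 (rnorm_add_le x.1 y.1),
          AEEqFun.coeFn_add (rnorm x.1) (rnorm y.1)] with ω h1 h2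
        rwa [h2] at h1
      neg' := fun x => by
        change ∫ ω, rnorm (-x.1) ω ∂P = _
        rw [rnorm_neg]
      eq_zero_of_map_eq_zero' := fun x hx => by
        apply Subtype.ext
        apply eq_zero_of_rnorm
        apply AEEqFun.ext
        exact ((integral_eq_zero_iff_of_nonneg_ae (L0.coeFn_nonneg (rnorm_nonneg x.1)) x.2).1
          hx).trans AEEqFun.coeFn_zero.symm }

theorem L1Part.norm_def (x : L1Part X) : ‖x‖ = ∫ ω, rnorm x.1 ω ∂P := rfl

noncomputable instance : NormedSpace ℝ (L1Part X) where
  norm_smul_le r x := by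
    rw [L1Part.norm_def, L1Part.norm_def, Real.norm_eq_abs, ← integral_const_mul]
    exact (integral_congr_ae (rnorm_rsmul r x.1)).le

variable [IsProbabilityMeasure P]

variable (X) in
/-- The inclusion of the integrable vectors. -/
def L1Part.incl : L1Part X →+ X := (integrableVectors X).subtype

theorem L1Part.continuous_incl : Continuous (L1Part.incl X) := by
  apply continuous_of_continuousAt_zero
  intro U hU
  rw [map_zero] at hU
  obtain ⟨ε, hε, hU⟩ := mem_nhds_zero.1 hU
  rw [mem_map, Metric.mem_nhds_iff]
  -- Markov's inequality: `ε P(‖x‖ ≥ ε) ≤ E‖x‖ < ε²`.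
  refine ⟨ε * ε, mul_pos hε hε, fun x hx => hU _ ?_⟩
  rw [mem_ball_zero_iff, L1Part.norm_def] at hx
  have h := mul_meas_ge_le_integral_of_nonneg (L0.coeFn_nonneg (rnorm_nonneg x.1)) x.2 ε
  exact lt_of_mul_lt_mul_left (lt_of_le_of_lt h hx) hε.le

variable [CompleteSpace X]

variable (X) in
/-- The extension of the inclusion to the Banach space completing the integrable vectors. -/
noncomputable def L1Part.extend : UniformSpace.Completion (L1Part X) →+ X :=
  (L1Part.incl X).extension L1Part.continuous_incl

theorem L1Part.continuous_extend : Continuous (L1Part.extend X) :=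
  AddMonoidHom.continuous_extension _ _

theorem L1Part.extend_coe (x : L1Part X) : L1Part.extend X x = x.1 :=
  AddMonoidHom.extension_coe _ L1Part.continuous_incl x

/-- The extension is built as an additive map only; real homogeneity, needed to carry Riemann sums
across, follows by density. -/
theorem L1Part.extend_smul (r : ℝ) (e : UniformSpace.Completion (L1Part X)) :
    L1Part.extend X (r • e) = rsmul K P r (L1Part.extend X e) := by
  induction e using UniformSpace.Completion.induction_on with
  | hp =>
    exact isClosed_eq (L1Part.continuous_extend.comp (continuous_const_smul r))
      ((continuous_rsmul r).comp L1Part.continuous_extend)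
  | ih x =>
    rw [← UniformSpace.Completion.coe_smul, L1Part.extend_coe, L1Part.extend_coe]
    rfl

end Integrable

/-! ### Lifting bounded continuous curves to a Banach space. -/

section Lift

variable {Ω : Type*} {mΩ : MeasurableSpace Ω} {K : Type*} [RCLike K] {P : Measure Ω}

/-- Quantitative bounded convergence. The constant `2` bounds the `L⁰`-norm of a difference of two
vectors of `L⁰`-norm at most `1`. -/
theorem integral_le_of_le_two [IsProbabilityMeasure P] {a b : L0 ℝ P} (ha : 0 ≤ a)
    (h2 : ∀ᵐ ω ∂P, a ω ≤ 2) (hab : ∀ᵐ ω ∂P, a ω ≤ b ω) {δ : ℝ} (hδ : 0 ≤ δ) :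
    ∫ ω, a ω ∂P ≤ δ + 2 * P.real {ω | δ ≤ b ω} := by
  have hm := L0.measurableSet_ge b δ
  have hi : Integrable (fun ω => δ + {ω | δ ≤ b ω}.indicator (fun _ => (2 : ℝ)) ω) P :=
    (integrable_const δ).add ((integrable_const _).indicator hm)
  calc ∫ ω, a ω ∂P ≤ ∫ ω, (δ + {ω | δ ≤ b ω}.indicator (fun _ => (2 : ℝ)) ω) ∂P := by
        refine integral_mono_of_nonneg (L0.coeFn_nonneg ha) hi ?_
        filter_upwards [h2, hab] with ω h3 h4
        by_cases h5 : δ ≤ b ω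
        · rw [indicator_of_mem (show ω ∈ {ω | δ ≤ b ω} from h5)]
          linarith
        · rw [indicator_of_notMem (show ω ∉ {ω | δ ≤ b ω} from h5)]
          linarith
    _ = _ := by
        rw [integral_add (integrable_const δ) ((integrable_const _).indicator hm),
          integral_indicator_const _ hm]
        simp [mul_comm]

variable (K) in
/-- A unit `v` of `L⁰(𝓕, K)` with `|v| ≤ 1` and `|v| |η| ≤ 1`. -/
theorem exists_damping (η : L0 ℝ P) : ∃ u v : L0 K P, u * v = 1 ∧
    ∀ᵐ ω ∂P, L0.modulus v ω ≤ 1 ∧ L0.modulus v ω * |η ω| ≤ 1 := by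
  have hc : Continuous fun r : ℝ => ((1 + |r| : ℝ) : K) := by fun_prop
  have hp : ∀ r : ℝ, 0 < 1 + |r| := fun r => by positivity
  have hc' : Continuous fun r : ℝ => (((1 + |r|)⁻¹ : ℝ) : K) := by
    apply RCLike.continuous_ofReal.comp
    exact Continuous.inv₀ (by fun_prop) fun r => (hp r).ne'
  refine ⟨AEEqFun.comp _ hc η, AEEqFun.comp _ hc' η, ?_, ?_⟩
  · apply AEEqFun.ext
    filter_upwards [AEEqFun.coeFn_mul (AEEqFun.comp _ hc η) (AEEqFun.comp _ hc' η),
      AEEqFun.coeFn_comp _ hc η, AEEqFun.coeFn_comp _ hc' η,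
      AEEqFun.coeFn_one (β := K) (μ := P)] with ω h1 h2 h3 h4
    rw [h1, h4, Pi.mul_apply, h2, h3, Function.comp, Function.comp, Pi.one_apply,
      ← RCLike.ofReal_mul, mul_inv_cancel₀ (hp _).ne', RCLike.ofReal_one]
  · filter_upwards [L0.coeFn_modulus (AEEqFun.comp _ hc' η), AEEqFun.coeFn_comp _ hc' η]
      with ω h1 h2
    have h3 : L0.modulus (AEEqFun.comp _ hc' η) ω = (1 + |η ω|)⁻¹ := by
      rw [h1, h2, Function.comp, RCLike.norm_ofReal, abs_of_pos (inv_pos.2 (hp _))]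
    rw [h3]
    constructor
    · exact inv_le_one_of_one_le₀ (by linarith [abs_nonneg (η ω)])
    · rw [inv_mul_le_iff₀ (hp _)]
      linarith

variable [IsProbabilityMeasure P]
  {X : Type*} [AddCommGroup X] [Module (L0 K P) X] [RNModule K P X] [CompleteSpace X]

/-- A continuous curve with an `L⁰`-bounded `L⁰`-norm factors through a continuous curve in a
Banach space. -/
theorem exists_continuous_lift {f : ℝ → X} {l : ℝ} (hl : 0 ≤ l) (hf : ContinuousOn f (Icc 0 l))
    {η : L0 ℝ P} (hη : ∀ s ∈ Icc 0 l, rnorm (f s) ≤ η) :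
    ∃ (F : ℝ → UniformSpace.Completion (L1Part X)) (L : UniformSpace.Completion (L1Part X) →+ X),
      Continuous F ∧ Continuous L ∧ (∀ r e, L (r • e) = rsmul K P r (L e)) ∧
      ∀ s ∈ Icc 0 l, L (F s) = f s := by
  obtain ⟨u, v, huv, hv⟩ := exists_damping K η
  have hbd : ∀ s ∈ Icc 0 l, ∀ᵐ ω ∂P, rnorm (v • f s) ω ≤ 1 := by
    intro s hs
    rw [rnorm_smul]
    filter_upwards [hv, AEEqFun.coeFn_mul (L0.modulus v) (rnorm (f s)),
      AEEqFun.coeFn_le.2 (hη s hs), L0.coeFn_nonneg (L0.modulus_nonneg v)] with ω h1 h2 h3 h4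
    rw [h2, Pi.mul_apply]
    exact (mul_le_mul_of_nonneg_left (h3.trans (le_abs_self _)) h4).trans h1.2
  have hint : ∀ s ∈ Icc 0 l, Integrable (rnorm (v • f s)) P := by
    intro s hs
    refine (integrable_const (1 : ℝ)).mono' (AEEqFun.aestronglyMeasurable _) ?_
    filter_upwards [hbd s hs, L0.coeFn_nonneg (rnorm_nonneg (v • f s))] with ω h1 h2
    rwa [Real.norm_of_nonneg h2]
  let g : Icc 0 l → L1Part X := fun s => ⟨v • f s, hint s s.2⟩
  have hg : Continuous g := by
    rw [continuous_iff_continuousAt]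
    intro t
    rw [ContinuousAt, Metric.tendsto_nhds]
    intro ε hε
    have h1 : Tendsto (fun s : Icc 0 l => f s) (𝓝 t) (𝓝 (f t)) :=
      (continuousOn_iff_continuous_domRestrict.1 hf).tendsto t
    -- With `δ = ε / 4` the integral is less than `ε / 4 + 2 · ε / 4 < ε`.
    filter_upwards [h1.eventually (eventually_nhds_measureReal_lt (f t)
      (show 0 < ε / 4 by positivity))] with s hs
    rw [dist_eq_norm, L1Part.norm_def]
    have h2 : (g s - g t).1 = v • (f s - f t) := (smul_sub v (f s) (f t)).symm
    rw [h2]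
    have h3 := integral_le_of_le_two (b := rnorm (f s - f t)) (rnorm_nonneg (v • (f s - f t)))
      ?_ ?_ (show 0 ≤ ε / 4 by positivity)
    · linarith
    · have h4 : rnorm (v • (f s - f t)) ≤ rnorm (v • f s) + rnorm (v • f t) := by
        rw [← rnorm_neg (v • f t), smul_sub, sub_eq_add_neg]
        exact rnorm_add_le _ _
      filter_upwards [hbd s s.2, hbd t t.2, AEEqFun.coeFn_le.2 h4,
        AEEqFun.coeFn_add (rnorm (v • f s)) (rnorm (v • f t))] with ω h5 h6 h7 h8
      rw [h8, Pi.add_apply] at h7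
      linarith
    · rw [rnorm_smul]
      filter_upwards [AEEqFun.coeFn_mul (L0.modulus v) (rnorm (f s - f t)), hv,
        L0.coeFn_nonneg (rnorm_nonneg (f s - f t))] with ω h5 h6 h7
      rw [h5, Pi.mul_apply]
      exact mul_le_of_le_one_left h7 h6.1
  -- `projIcc` continues the curve constantly outside `[0, l]`; the factor `u` undoes the damping by
  -- `v`.
  refine ⟨fun s => (g (projIcc 0 l hl s) : UniformSpace.Completion (L1Part X)),
    (DistribSMul.toAddMonoidHom X u).comp (L1Part.extend X), ?_, ?_, ?_, ?_⟩
  · exact (UniformSpace.Completion.continuous_coe _).comp (hg.comp continuous_projIcc)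
  · exact (continuous_const_smul u).comp L1Part.continuous_extend
  · intro r e
    change u • L1Part.extend X (r • e) = rsmul K P r (u • L1Part.extend X e)
    rw [L1Part.extend_smul, rsmul_smul]
  · intro s hs
    change u • L1Part.extend X (g (projIcc 0 l hl s)) = f s
    rw [L1Part.extend_coe, projIcc_of_mem hl hs]
    change u • v • f s = f s
    rw [← mul_smul, huv, one_smul]

end Lift

end RNModule

/-! ### Tagged partitions and Riemann sums. -/

namespace RNModule

namespace TaggedPartition

variable {a b : ℝ}

theorem pt_mono (π : TaggedPartition a b) {i j : ℕ} (hij : i ≤ j) (hj : j ≤ π.n) :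
    π.pt i ≤ π.pt j := by
  induction j, hij using Nat.le_induction with
  | base => exact le_rfl
  | succ j _ ih => exact (ih (by omega)).trans (π.pt_le j (by omega))

theorem pt_mem (π : TaggedPartition a b) {i : ℕ} (hi : i ≤ π.n) : π.pt i ∈ Icc a b := by
  have h1 := π.pt_mono (Nat.zero_le i) hi
  have h2 := π.pt_mono hi le_rfl
  rw [π.pt_zero] at h1
  rw [π.pt_last] at h2
  exact ⟨h1, h2⟩

theorem tag_mem_Icc (π : TaggedPartition a b) {i : ℕ} (hi : i < π.n) : π.tag i ∈ Icc a b :=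
  ⟨(π.pt_mem hi.le).1.trans (π.tag_mem i hi).1, (π.tag_mem i hi).2.trans (π.pt_mem hi).2⟩

theorem sum_length (π : TaggedPartition a b) :
    ∑ i ∈ Finset.range π.n, (π.pt (i + 1) - π.pt i) = b - a := by
  rw [Finset.sum_range_sub, π.pt_zero, π.pt_last]

theorem exists_mesh_lt (hab : a ≤ b) {δ : ℝ} (hδ : 0 < δ) :
    ∃ π : TaggedPartition a b, ∀ i < π.n, π.pt (i + 1) - π.pt i < δ := by
  obtain ⟨n, hn⟩ := exists_nat_gt ((b - a) / δ)
  have hn1 : (0 : ℝ) < n + 1 := by positivity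
  have hstep : ∀ i : ℕ, (a + ((i + 1 : ℕ) : ℝ) * ((b - a) / (n + 1))) -
      (a + (i : ℝ) * ((b - a) / (n + 1))) = (b - a) / (n + 1) := by
    intro i
    push_cast
    ring
  have hpos : 0 ≤ (b - a) / (n + 1) := div_nonneg (sub_nonneg.2 hab) hn1.le
  have hle : ∀ i : ℕ, a + (i : ℝ) * ((b - a) / (n + 1)) ≤
      a + ((i + 1 : ℕ) : ℝ) * ((b - a) / (n + 1)) := fun i => by
    linarith [hstep i]
  refine ⟨⟨n + 1, fun i => a + i * ((b - a) / (n + 1)), fun i => a + i * ((b - a) / (n + 1)),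
    by simp, ?_, fun i _ => hle i, fun i _ => ⟨le_rfl, hle i⟩⟩, fun i _ => ?_⟩
  · push_cast
    field_simp
    ring
  · change (a + ((i + 1 : ℕ) : ℝ) * ((b - a) / (n + 1))) -
      (a + (i : ℝ) * ((b - a) / (n + 1))) < δ
    rw [hstep, div_lt_iff₀ hn1]
    rw [div_lt_iff₀ hδ] at hn
    nlinarith

/-- The filter of tagged partitions whose mesh tends to `0`. -/
def meshFilter (a b : ℝ) : Filter (TaggedPartition a b) :=
  ⨅ δ : Ioi (0 : ℝ), 𝓟 {π | ∀ i < π.n, π.pt (i + 1) - π.pt i < δ}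

theorem hasBasis_meshFilter (a b : ℝ) : (meshFilter a b).HasBasis (fun δ : ℝ => 0 < δ)
    fun δ => {π | ∀ i < π.n, π.pt (i + 1) - π.pt i < δ} := by
  have h := hasBasis_iInf_principal (ι := Ioi (0 : ℝ))
    (s := fun δ => {π : TaggedPartition a b | ∀ i < π.n, π.pt (i + 1) - π.pt i < δ})
    (fun δ δ' => ⟨⟨min δ δ', mem_Ioi.2 (lt_min (mem_Ioi.1 δ.2) (mem_Ioi.1 δ'.2))⟩,
      fun π hπ i hi => (hπ i hi).trans_le (min_le_left _ _),
      fun π hπ i hi => (hπ i hi).trans_le (min_le_right _ _)⟩)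
  refine ⟨fun t => (h.mem_iff).trans ?_⟩
  simp only [true_and, Subtype.exists, mem_Ioi, exists_prop]

/-- Partitions of arbitrarily small mesh exist, so Riemann integrals are unique as limits in a
Hausdorff space. -/
theorem meshFilter_neBot (hab : a ≤ b) : (meshFilter a b).NeBot :=
  (hasBasis_meshFilter a b).neBot_iff.2 fun hδ => exists_mesh_lt hab hδ

theorem tendsto_sum_integral {E : Type*} [NormedAddCommGroup E] [NormedSpace ℝ E]
    [CompleteSpace E] {F : ℝ → E} (hF : Continuous F) (hab : a ≤ b) :
    Tendsto (fun π : TaggedPartition a b =>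
      ∑ i ∈ Finset.range π.n, (π.pt (i + 1) - π.pt i) • F (π.tag i)) (meshFilter a b)
      (𝓝 (∫ u in a..b, F u)) := by
  rw [((hasBasis_meshFilter a b).tendsto_iff Metric.nhds_basis_closedBall)]
  intro ε hε
  -- The added `1` covers the degenerate interval `a = b`.
  have hc : 0 < b - a + 1 := by linarith
  obtain ⟨δ, hδ, hu⟩ := Metric.uniformContinuousOn_iff.1
    (isCompact_Icc.uniformContinuousOn_of_continuous (hF.continuousOn (s := Icc a b)))
    (ε / (b - a + 1)) (div_pos hε hc)
  refine ⟨δ, hδ, fun π hπ => ?_⟩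
  have hint : ∀ c d : ℝ, IntervalIntegrable F volume c d := fun c d => hF.intervalIntegrable c d
  have h1 : ∑ i ∈ Finset.range π.n, ∫ u in π.pt i..π.pt (i + 1), F u = ∫ u in a..b, F u := by
    rw [intervalIntegral.sum_integral_adjacent_intervals fun k _ => hint _ _, π.pt_zero, π.pt_last]
  rw [mem_closedBall_iff_norm, ← h1, ← Finset.sum_sub_distrib]
  calc _ ≤ ∑ i ∈ Finset.range π.n, ε / (b - a + 1) * (π.pt (i + 1) - π.pt i) := by
        refine norm_sum_le_of_le _ fun i hi => ?_
        have hi := Finset.mem_range.1 hi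
        rw [← intervalIntegral.integral_const, ← intervalIntegral.integral_sub
          intervalIntegrable_const (hint _ _), ← abs_of_nonneg (sub_nonneg.2 (π.pt_le i hi))]
        refine intervalIntegral.norm_integral_le_of_norm_le_const fun u hu' => ?_
        rw [uIoc_of_le (π.pt_le i hi)] at hu'
        rw [← dist_eq_norm]
        refine (hu _ (π.tag_mem_Icc hi) _ ⟨(π.pt_mem hi.le).1.trans hu'.1.le,
          hu'.2.trans (π.pt_mem hi).2⟩ ?_).le
        rw [Real.dist_eq, abs_lt]
        have h2 := π.tag_mem i hi
        have h3 := hπ i hi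
        constructor <;> linarith [h2.1, h2.2, hu'.1, hu'.2]
    _ ≤ ε := by
        rw [← Finset.mul_sum, π.sum_length, div_mul_eq_mul_div, div_le_iff₀ hc]
        nlinarith

end TaggedPartition

/-! ### Riemann integrals in random normed modules. -/

section Riemann

variable {Ω : Type*} {mΩ : MeasurableSpace Ω} {K : Type*} [RCLike K] {P : Measure Ω}
  [IsProbabilityMeasure P]
  {X : Type*} [AddCommGroup X] [Module (L0 K P) X] [RNModule K P X] {f g : ℝ → X} {a b : ℝ}
  {I J : X}

theorem hasRiemannIntegral_iff : HasRiemannIntegral K P f a b I ↔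
    Tendsto (riemannSum K P f) (TaggedPartition.meshFilter a b) (𝓝 I) :=
  ((TaggedPartition.hasBasis_meshFilter a b).tendsto_iff (basis_sets _)).symm

theorem HasRiemannIntegral.unique (hab : a ≤ b) (hI : HasRiemannIntegral K P f a b I)
    (hJ : HasRiemannIntegral K P f a b J) : I = J :=
  have := TaggedPartition.meshFilter_neBot hab
  tendsto_nhds_unique (hasRiemannIntegral_iff.1 hI) (hasRiemannIntegral_iff.1 hJ)

theorem HasRiemannIntegral.riemannIntegral_eq (hab : a ≤ b)
    (hI : HasRiemannIntegral K P f a b I) : riemannIntegral K P f a b = I := by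
  have h : RiemannIntegrable K P f a b := ⟨I, hI⟩
  rw [riemannIntegral, dif_pos h]
  exact h.choose_spec.unique hab hI

theorem HasRiemannIntegral.congr (hI : HasRiemannIntegral K P f a b I)
    (h : ∀ u ∈ Icc a b, f u = g u) : HasRiemannIntegral K P g a b I := by
  have : riemannSum K P f = (riemannSum K P g : TaggedPartition a b → X) := by
    funext π
    exact Finset.sum_congr rfl fun i hi => by
      rw [h _ (π.tag_mem_Icc (Finset.mem_range.1 hi))]
  rw [hasRiemannIntegral_iff] at hI ⊢
  rwa [← this]

theorem HasRiemannIntegral.map (hI : HasRiemannIntegral K P f a b I) (T : X →L[L0 K P] X) :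
    HasRiemannIntegral K P (fun u => T (f u)) a b (T I) := by
  rw [hasRiemannIntegral_iff] at hI ⊢
  have h := (T.continuous.tendsto I).comp hI
  refine h.congr fun π => ?_
  rw [Function.comp, riemannSum, riemannSum, map_sum]
  exact Finset.sum_congr rfl fun i _ => map_rsmul T.toLinearMap _ _

theorem HasRiemannIntegral.add (hI : HasRiemannIntegral K P f a b I)
    (hJ : HasRiemannIntegral K P g a b J) :
    HasRiemannIntegral K P (fun u => f u + g u) a b (I + J) := by
  rw [hasRiemannIntegral_iff] at hI hJ ⊢
  refine (hI.add hJ).congr fun π => ?_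
  rw [riemannSum, riemannSum, riemannSum, ← Finset.sum_add_distrib]
  exact Finset.sum_congr rfl fun i _ => (smul_add _ _ _).symm

/-- Every Riemann sum obeys the bound, by induction on its partial sums, and the bound survives the
limit by `isClosed_rnorm_le`. -/
theorem HasRiemannIntegral.rnorm_le (hab : a ≤ b) (hI : HasRiemannIntegral K P f a b I)
    {η : L0 ℝ P} (hη : ∀ u ∈ Icc a b, rnorm (f u) ≤ η) :
    rnorm I ≤ L0.realConst ℝ P (b - a) * η := by
  have := TaggedPartition.meshFilter_neBot hab
  refine (isClosed_rnorm_le _).mem_of_tendsto (hasRiemannIntegral_iff.1 hI)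
    (Eventually.of_forall fun π => ?_)
  have h : ∀ n ≤ π.n, rnorm (∑ i ∈ Finset.range n,
      rsmul K P (π.pt (i + 1) - π.pt i) (f (π.tag i))) ≤
        L0.realConst ℝ P (π.pt n - π.pt 0) * η := by
    intro n hn
    induction n with
    | zero => simp [rnorm_zero]
    | succ n ih =>
      rw [Finset.sum_range_succ]
      refine (rnorm_add_le _ _).trans ?_
      rw [← AEEqFun.coeFn_le]
      filter_upwards [AEEqFun.coeFn_add (rnorm (∑ i ∈ Finset.range n,
          rsmul K P (π.pt (i + 1) - π.pt i) (f (π.tag i))))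
          (rnorm (rsmul K P (π.pt (n + 1) - π.pt n) (f (π.tag n)))),
        L0.coeFn_le_mul (ih (by omega)), rnorm_rsmul (π.pt (n + 1) - π.pt n) (f (π.tag n)),
        AEEqFun.coeFn_le.2 (hη _ (π.tag_mem_Icc hn)),
        AEEqFun.coeFn_mul (L0.realConst ℝ P (π.pt (n + 1) - π.pt 0)) η,
        L0.coeFn_realConst (K := ℝ) (P := P) (π.pt (n + 1) - π.pt 0),
        L0.coeFn_realConst (K := ℝ) (P := P) (π.pt n - π.pt 0)] with ω h1 h2 h3 h4 h5 h6 h7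
      have h8 : 0 ≤ π.pt (n + 1) - π.pt n := sub_nonneg.2 (π.pt_le n hn)
      rw [h1, Pi.add_apply, h3, h5, Pi.mul_apply, h6, abs_of_nonneg h8]
      rw [h7] at h2
      simp only [RCLike.ofReal_real_eq_id, id_eq] at h2 ⊢
      nlinarith
  have h' := h π.n le_rfl
  rwa [π.pt_zero, π.pt_last] at h'

variable {E : Type*} [NormedAddCommGroup E] [NormedSpace ℝ E] [CompleteSpace E]

/-- `L` maps Riemann sums of `F` to those of `f`, and its continuity transports their limit. -/
theorem hasRiemannIntegral_of_lift {F : ℝ → E} {L : E →+ X} (hF : Continuous F)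
    (hL : Continuous L) (hLr : ∀ r e, L (r • e) = rsmul K P r (L e)) (hab : a ≤ b)
    (h : ∀ u ∈ Icc a b, L (F u) = f u) :
    HasRiemannIntegral K P f a b (L (∫ u in a..b, F u)) := by
  rw [hasRiemannIntegral_iff]
  refine ((hL.tendsto _).comp (TaggedPartition.tendsto_sum_integral hF hab)).congr fun π => ?_
  rw [Function.comp, map_sum]
  exact Finset.sum_congr rfl fun i hi => by
    rw [hLr, h _ (π.tag_mem_Icc (Finset.mem_range.1 hi))]

end Riemann

/-- A curve on `[0, ∞)` that is continuous and whose `L⁰`-norm is locally bounded in `L⁰`. -/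
structure IsLocallyBoundedCurve {Ω : Type*} {mΩ : MeasurableSpace Ω} {K : Type*} [RCLike K]
    {P : Measure Ω} [IsProbabilityMeasure P]
    {X : Type*} [AddCommGroup X] [Module (L0 K P) X] [RNModule K P X] (f : ℝ → X) : Prop where
  continuousOn : ContinuousOn f (Ici 0)
  bounded : ∀ l : ℝ, 0 < l → ∃ η : L0 ℝ P, ∀ s ∈ Icc 0 l, rnorm (f s) ≤ η

/-! ### Calculus for locally bounded curves. -/

namespace IsLocallyBoundedCurve

variable {Ω : Type*} {mΩ : MeasurableSpace Ω} {K : Type*} [RCLike K] {P : Measure Ω}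
  [IsProbabilityMeasure P]
  {X : Type*} [AddCommGroup X] [Module (L0 K P) X] [RNModule K P X] [CompleteSpace X]
  {f : ℝ → X}

theorem exists_lift (hf : IsLocallyBoundedCurve f) {l : ℝ} (hl : 0 < l) :
    ∃ (F : ℝ → UniformSpace.Completion (L1Part X)) (L : UniformSpace.Completion (L1Part X) →+ X),
      Continuous F ∧ Continuous L ∧ (∀ r e, L (r • e) = rsmul K P r (L e)) ∧
      ∀ s ∈ Icc 0 l, L (F s) = f s := by
  obtain ⟨η, hη⟩ := hf.bounded l hl
  exact exists_continuous_lift hl.le (hf.continuousOn.mono Icc_subset_Ici_self) hη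

theorem hasRiemannIntegral (hf : IsLocallyBoundedCurve f) {s : ℝ} (hs : 0 ≤ s) :
    HasRiemannIntegral K P f 0 s (riemannIntegral K P f 0 s) := by
  obtain ⟨F, L, hF, hL, hLr, h⟩ := hf.exists_lift (l := s + 1) (by linarith)
  have h1 := hasRiemannIntegral_of_lift hF hL hLr hs (f := f)
    fun u hu => h u ⟨hu.1, by linarith [hu.2]⟩
  rwa [h1.riemannIntegral_eq hs]

theorem hasRiemannIntegral_shift (hf : IsLocallyBoundedCurve f) {s h : ℝ} (hs : 0 ≤ s)
    (hh : 0 ≤ h) :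
    HasRiemannIntegral K P (fun u => f (h + u)) 0 s
      (riemannIntegral K P f 0 (s + h) - riemannIntegral K P f 0 h) := by
  obtain ⟨F, L, hF, hL, hLr, hfF⟩ := hf.exists_lift (l := s + h + 1) (by linarith)
  have h1 := hasRiemannIntegral_of_lift hF hL hLr (add_nonneg hs hh) (f := f)
    fun u hu => hfF u ⟨hu.1, by linarith [hu.2]⟩
  have h2 := hasRiemannIntegral_of_lift hF hL hLr hh (f := f)
    fun u hu => hfF u ⟨hu.1, by linarith [hu.2]⟩
  have h3 := hasRiemannIntegral_of_lift (F := fun u => F (h + u)) (by fun_prop) hL hLr hs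
    (f := fun u => f (h + u))
    fun u hu => hfF (h + u) ⟨add_nonneg hh hu.1, by linarith [hu.2]⟩
  rw [h1.riemannIntegral_eq (add_nonneg hs hh), h2.riemannIntegral_eq hh, ← map_sub,
    intervalIntegral.integral_interval_sub_left (hF.intervalIntegrable _ _)
      (hF.intervalIntegrable _ _)]
  rwa [intervalIntegral.integral_comp_add_left, add_zero, add_comm h s] at h3

/-- The fundamental theorem of calculus. -/
theorem hasDerivOnHalfLine (hf : IsLocallyBoundedCurve f) {s : ℝ} (hs : 0 ≤ s) :
    HasDerivOnHalfLine K P (fun r => riemannIntegral K P f 0 r) (f s) s := by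
  -- The lift must extend to the right of `s`, since the difference quotients use nearby `r > s`.
  obtain ⟨F, L, hF, hL, hLr, hfF⟩ := hf.exists_lift (l := s + 1) (by linarith)
  have h1 : ∀ r ∈ Icc 0 (s + 1), riemannIntegral K P f 0 r = L (∫ u in (0 : ℝ)..r, F u) :=
    fun r hr => (hasRiemannIntegral_of_lift hF hL hLr hr.1
      fun u hu => hfF u ⟨hu.1, hu.2.trans hr.2⟩).riemannIntegral_eq hr.1
  have h2 : HasDerivAt (fun r => ∫ u in (0 : ℝ)..r, F u) (F s) s :=
    intervalIntegral.integral_hasDerivAt_right (hF.intervalIntegrable _ _)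
      (hF.stronglyMeasurableAtFilter _ _) hF.continuousAt
  have h3 := (hL.tendsto _).comp (hasDerivAt_iff_tendsto_slope.1 h2)
  have hs1 : s ∈ Icc 0 (s + 1) := ⟨hs, by linarith⟩
  rw [hfF s hs1] at h3
  refine (h3.mono_left (nhdsWithin_mono s fun r hr => hr.2)).congr' ?_
  filter_upwards [self_mem_nhdsWithin,
    mem_nhdsWithin_of_mem_nhds (Iio_mem_nhds (show s < s + 1 by linarith))] with r hr hr'
  rw [Function.comp, slope_def_module, hLr, map_sub, h1 r ⟨hr.1, le_of_lt hr'⟩, h1 s hs1]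

end IsLocallyBoundedCurve

end RNModule

/-! ### `C`-semigroups and their generators. -/

namespace RNModule

section Semigroup

variable {Ω : Type*} {mΩ : MeasurableSpace Ω} {K : Type*} [RCLike K] {P : Measure Ω}
  [IsProbabilityMeasure P]
  {X : Type*} [AddCommGroup X] [Module (L0 K P) X] [RNModule K P X]

/-- The infimum is itself admissible: `‖T z‖ / ‖z‖` lies below every admissible `η`, hence below
`ν`. -/
theorem IsOpNorm.rnorm_le {T : X →L[L0 K P] X} {ν : L0 ℝ P} (hT : IsOpNorm T ν) (z : X) :
    rnorm (T z) ≤ ν * rnorm z := by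
  obtain ⟨η, -, hη⟩ : {η : L0 ℝ P | 0 ≤ η ∧ ∀ z : X, rnorm (T z) ≤ η * rnorm z}.Nonempty := by
    by_contra h
    -- Every element is a lower bound of the empty set, so `ν` would be a greatest element of `L⁰`.
    have h1 : ν + 1 ≤ ν := hT.2 (by rw [not_nonempty_iff_eq_empty.1 h]; simp)
    have h2 : ∀ᵐ ω ∂P, False := by
      filter_upwards [AEEqFun.coeFn_le.2 h1, AEEqFun.coeFn_add ν 1,
        AEEqFun.coeFn_one (β := ℝ) (μ := P)] with ω h3 h4 h5
      rw [h4, Pi.add_apply, h5, Pi.one_apply] at h3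
      linarith
    obtain ⟨_, h3⟩ := h2.exists
    exact h3
  have hm : AEStronglyMeasurable (fun ω => rnorm (T z) ω / rnorm z ω) P :=
    ((AEEqFun.measurable _).div (AEEqFun.measurable _)).aestronglyMeasurable
  have h1 : AEEqFun.mk _ hm ≤ ν := by
    refine hT.2 fun η' hη' => ?_
    rw [← AEEqFun.coeFn_le]
    filter_upwards [AEEqFun.coeFn_mk _ hm, L0.coeFn_le_mul (hη'.2 z), L0.coeFn_nonneg hη'.1,
      L0.coeFn_nonneg (rnorm_nonneg z)] with ω h2 h3 h4 h5
    rw [h2]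
    exact div_le_of_le_mul₀ h5 h4 h3
  rw [← AEEqFun.coeFn_le]
  filter_upwards [AEEqFun.coeFn_mk _ hm, AEEqFun.coeFn_le.2 h1, L0.coeFn_le_mul (hη z),
    L0.coeFn_nonneg (rnorm_nonneg z), AEEqFun.coeFn_mul ν (rnorm z)] with ω h2 h3 h4 h5 h6
  rw [h6, Pi.mul_apply]
  -- Where `‖z‖ = 0` the quotient is `0` by convention and carries no information; there the
  -- admissible `η` forces `‖T z‖ = 0`.
  rcases h5.eq_or_lt with h7 | h7
  · rw [← h7, mul_zero] at h4 ⊢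
    exact h4
  · rwa [h2, div_le_iff₀ h7] at h3

theorem LocallyASBounded.exists_bound {V : ℝ → X →L[L0 K P] X} (hb : LocallyASBounded V) {l : ℝ}
    (hl : 0 < l) : ∃ ξ : L0 ℝ P, ∀ s ∈ Icc 0 l, ∀ z, rnorm (V s z) ≤ ξ * rnorm z := by
  obtain ⟨ν, hν, ξ, -, hξ⟩ := hb l hl
  refine ⟨ξ, fun s hs z => ((hν s hs).rnorm_le z).trans ?_⟩
  rw [← AEEqFun.coeFn_le]
  filter_upwards [AEEqFun.coeFn_le.2 (hξ.1 (mem_image_of_mem ν hs)),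
    L0.coeFn_nonneg (rnorm_nonneg z), AEEqFun.coeFn_mul ξ (rnorm z),
    AEEqFun.coeFn_mul (ν s) (rnorm z)] with ω h1 h2 h3 h4
  rw [h3, h4]
  exact mul_le_mul_of_nonneg_right h1 h2

variable {C : X →L[L0 K P] X} {V : ℝ → X →L[L0 K P] X}

theorem mem_rightLimitQuotient {z w : X} : w ∈ rightLimitQuotient C V z ↔
    Tendsto (fun s : ℝ => rsmul K P s⁻¹ (V s z - C z)) (𝓝[>] 0) (𝓝 w) := by
  constructor
  · rintro ⟨h, rfl⟩
    exact h.choose_spec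
  · intro h
    have h' : ∃ y : X, Tendsto (fun s : ℝ => rsmul K P s⁻¹ (V s z - C z)) (𝓝[>] 0) (𝓝 y) := ⟨w, h⟩
    exact ⟨h', tendsto_nhds_unique h'.choose_spec h⟩

theorem IsCSemigroup.mem_cInv (hV : IsCSemigroup C V) {y w : X} : y ∈ cInv C w ↔ C y = w := by
  constructor
  · rintro ⟨h, rfl⟩
    exact h.choose_spec
  · intro h
    have h' : w ∈ range C := ⟨y, h⟩
    exact ⟨h', hV.injective (h'.choose_spec.trans h.symm)⟩

/-- Uniqueness of limits and injectivity of `C` remove the choices hidden in the two partial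
functions. -/
theorem IsCSemigroup.mem_generator (hV : IsCSemigroup C V) {z y : X} :
    y ∈ generator C V z ↔
      Tendsto (fun s : ℝ => rsmul K P s⁻¹ (V s z - C z)) (𝓝[>] 0) (𝓝 (C y)) := by
  rw [← mem_rightLimitQuotient]
  refine Part.mem_bind_iff.trans ⟨?_, fun h => ⟨C y, h, hV.mem_cInv.2 rfl⟩⟩
  rintro ⟨w, hw, hy⟩
  rwa [hV.mem_cInv.1 hy]

theorem IsCSemigroup.comm (hV : IsCSemigroup C V) {s t : ℝ} (hs : 0 ≤ s) (ht : 0 ≤ t) (z : X) :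
    V s (V t z) = V t (V s z) := by
  rw [← hV.mul s t hs ht, ← hV.mul t s ht hs, add_comm]

theorem IsCSemigroup.comm_C (hV : IsCSemigroup C V) {s : ℝ} (hs : 0 ≤ s) (z : X) :
    V s (C z) = C (V s z) := by
  have h := hV.comm hs le_rfl z
  rwa [hV.map_zero] at h

theorem IsCSemigroup.map_mem_generator (hV : IsCSemigroup C V) {z y : X}
    (hy : y ∈ generator C V z) {s : ℝ} (hs : 0 ≤ s) :
    V s y ∈ generator C V (V s z) := by
  rw [hV.mem_generator] at hy ⊢
  rw [← hV.comm_C hs y]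
  refine (((V s).continuous.tendsto _).comp hy).congr' ?_
  filter_upwards [self_mem_nhdsWithin] with h hh
  have hh : 0 < h := hh
  rw [Function.comp, rsmul_eq, map_smul, map_sub, hV.comm hs hh.le, hV.comm_C hs]
  rfl

theorem IsCSemigroup.isLocallyBoundedCurve (hV : IsCSemigroup C V) (hb : LocallyASBounded V)
    (z : X) : IsLocallyBoundedCurve fun s => V s z where
  continuousOn := hV.strongly_continuous z
  bounded l hl := by
    obtain ⟨ξ, hξ⟩ := hb.exists_bound hl
    exact ⟨_, fun s hs => hξ s hs z⟩

theorem tendsto_rsmul_integral [CompleteSpace X] {f : ℝ → X} (hf : IsLocallyBoundedCurve f) :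
    Tendsto (fun s : ℝ => rsmul K P s⁻¹ (riemannIntegral K P f 0 s)) (𝓝[>] 0) (𝓝 (f 0)) := by
  -- The shift formula with `s = h = 0` expresses this integral as a difference of equal terms.
  have h0 : riemannIntegral K P f 0 0 = 0 := by
    have h := (hf.hasRiemannIntegral_shift le_rfl le_rfl).riemannIntegral_eq le_rfl
    simpa using h
  have h := hf.hasDerivOnHalfLine le_rfl
  rw [HasDerivOnHalfLine] at h
  simp only [h0, sub_zero] at h
  exact h.mono_left (nhdsWithin_mono 0 fun r (hr : 0 < r) => ⟨hr.le, hr.ne'⟩)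

variable [CompleteSpace X]

/-- The operator `z ↦ ∫₀ˢ V(u) z du`. -/
noncomputable def semigroupIntegral (hV : IsCSemigroup C V) (hb : LocallyASBounded V) {s : ℝ}
    (hs : 0 ≤ s) : X →L[L0 K P] X :=
  let J : X →ₗ[L0 K P] X :=
    { toFun := fun z => riemannIntegral K P (fun u => V u z) 0 s
      map_add' := fun x y => by
        refine HasRiemannIntegral.riemannIntegral_eq hs ?_
        refine (((hV.isLocallyBoundedCurve hb x).hasRiemannIntegral hs).add
          ((hV.isLocallyBoundedCurve hb y).hasRiemannIntegral hs)).congr fun u _ => ?_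
        exact ((V u).map_add x y).symm
      map_smul' := fun ξ x => by
        refine HasRiemannIntegral.riemannIntegral_eq hs ?_
        refine (((hV.isLocallyBoundedCurve hb x).hasRiemannIntegral hs).map
          ⟨LinearMap.lsmul (L0 K P) X ξ, continuous_const_smul ξ⟩).congr fun u _ => ?_
        exact ((V u).map_smul ξ x).symm }
  ⟨J, by
    obtain ⟨ξ, hξ⟩ := hb.exists_bound (l := s + 1) (by linarith)
    refine continuous_of_rnorm_le J.toAddMonoidHom (L0.realConst ℝ P (s - 0) * ξ) fun x => ?_
    rw [mul_assoc]
    exact ((hV.isLocallyBoundedCurve hb x).hasRiemannIntegral hs).rnorm_le hs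
      fun u hu => hξ u ⟨hu.1, by linarith [hu.2]⟩ x⟩

theorem semigroupIntegral_apply (hV : IsCSemigroup C V) (hb : LocallyASBounded V)
    {s : ℝ} (hs : 0 ≤ s) (z : X) :
    semigroupIntegral hV hb hs z = riemannIntegral K P (fun u => V u z) 0 s := rfl

theorem hasRiemannIntegral_semigroup (hV : IsCSemigroup C V) (hb : LocallyASBounded V)
    {s : ℝ} (hs : 0 ≤ s) (z : X) :
    HasRiemannIntegral K P (fun u => V u z) 0 s (semigroupIntegral hV hb hs z) :=
  (hV.isLocallyBoundedCurve hb z).hasRiemannIntegral hs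

theorem semigroupIntegral_comm (hV : IsCSemigroup C V) (hb : LocallyASBounded V)
    {s h : ℝ} (hs : 0 ≤ s) (hh : 0 ≤ h) (z : X) :
    semigroupIntegral hV hb hs (V h z) = V h (semigroupIntegral hV hb hs z) :=
  (hasRiemannIntegral_semigroup hV hb hs (V h z)).unique hs
    (((hasRiemannIntegral_semigroup hV hb hs z).map (V h)).congr
      fun _ hu => hV.comm hh hu.1 z)

theorem semigroupIntegral_comm_C (hV : IsCSemigroup C V) (hb : LocallyASBounded V)
    {s : ℝ} (hs : 0 ≤ s) (z : X) :
    semigroupIntegral hV hb hs (C z) = C (semigroupIntegral hV hb hs z) := by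
  have h := semigroupIntegral_comm hV hb hs le_rfl z
  rwa [hV.map_zero] at h

/-- Under the integral sign `V(h) V(u) z = C V(h + u) z`, and translating the variable leaves `C
∫_h^{s+h} V(u) z du`. -/
theorem semigroup_apply_semigroupIntegral (hV : IsCSemigroup C V) (hb : LocallyASBounded V)
    {s h : ℝ} (hs : 0 ≤ s) (hh : 0 ≤ h) (z : X) :
    V h (semigroupIntegral hV hb hs z) =
      C (riemannIntegral K P (fun u => V u z) 0 (s + h) -
        riemannIntegral K P (fun u => V u z) 0 h) :=
  ((hasRiemannIntegral_semigroup hV hb hs z).map (V h)).unique hs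
    ((((hV.isLocallyBoundedCurve hb z).hasRiemannIntegral_shift hs hh).map C).congr
      fun u hu => hV.mul h u hh hu.1 z)

/-- The difference quotient of `J_s z` is `C` applied to the mean of `V(u) z` over `[s, s + h]`
minus that over `[0, h]`. With `C` outside, the limit `C (V(s) z - C z)` lies in `R(C)`. -/
theorem sub_mem_generator_semigroupIntegral (hV : IsCSemigroup C V) (hb : LocallyASBounded V)
    {s : ℝ} (hs : 0 ≤ s) (z : X) :
    V s z - C z ∈ generator C V (semigroupIntegral hV hb hs z) := by
  rw [hV.mem_generator]
  have hf := hV.isLocallyBoundedCurve hb z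
  have h1 := tendsto_rsmul_integral hf
  have h2 : Tendsto (fun h : ℝ => s + h) (𝓝[>] 0) (𝓝[Ici 0 \ {s}] s) := by
    refine tendsto_nhdsWithin_iff.2 ⟨?_, ?_⟩
    · have : Tendsto (fun h : ℝ => s + h) (𝓝 0) (𝓝 (s + 0)) := by
        exact (continuous_const.add continuous_id).tendsto 0
      rw [add_zero] at this
      exact this.mono_left nhdsWithin_le_nhds
    · filter_upwards [self_mem_nhdsWithin] with h hh
      have hh : 0 < h := hh
      exact ⟨add_nonneg hs hh.le, fun h3 => by linarith [mem_singleton_iff.1 h3]⟩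
  have h3 := (hf.hasDerivOnHalfLine hs).comp h2
  have h4 := (C.continuous.tendsto _).comp (h3.sub h1)
  rw [hV.map_zero] at h4
  refine h4.congr' ?_
  filter_upwards [self_mem_nhdsWithin] with h hh
  have hh : 0 < h := hh
  rw [semigroup_apply_semigroupIntegral hV hb hs hh.le, ← map_sub, semigroupIntegral_apply]
  simp only [Function.comp, add_sub_cancel_left, rsmul_eq]
  rw [← smul_sub, C.map_smul, sub_right_comm]

/-- The integrated description of the generator. -/
theorem mem_generator_iff_integral (hV : IsCSemigroup C V) (hb : LocallyASBounded V)
    {z y : X} : y ∈ generator C V z ↔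
    ∀ s : ℝ, ∀ hs : 0 ≤ s, semigroupIntegral hV hb hs y = V s z - C z := by
  constructor
  · intro hy s hs
    rw [hV.mem_generator] at hy
    apply hV.injective
    -- `J_s` maps the difference quotients of `z` to those of `J_s z`, so their limits `C J_s y` and
    -- `C (V(s) z - C z)` coincide.
    have h1 := ((semigroupIntegral hV hb hs).continuous.tendsto _).comp hy
    have h2 := hV.mem_generator.1 (sub_mem_generator_semigroupIntegral hV hb hs z)
    rw [← semigroupIntegral_comm_C]
    refine tendsto_nhds_unique (h1.congr' ?_) h2
    filter_upwards [self_mem_nhdsWithin] with h hh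
    have hh : 0 < h := hh
    rw [Function.comp, rsmul_eq, map_smul, map_sub, semigroupIntegral_comm hV hb hs hh.le,
      semigroupIntegral_comm_C]
    rfl
  · intro h
    rw [hV.mem_generator]
    have h1 := tendsto_rsmul_integral (hV.isLocallyBoundedCurve hb y)
    rw [hV.map_zero] at h1
    refine h1.congr' ?_
    filter_upwards [self_mem_nhdsWithin] with s hs
    have hs : 0 < s := hs
    rw [← h s hs.le, semigroupIntegral_apply]

/-- On `[0, ∞)`, `V(r) z` differs from `∫₀ʳ V(u) y du` by the constant `C z`. -/
theorem hasDerivOnHalfLine_semigroup (hV : IsCSemigroup C V) (hb : LocallyASBounded V)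
    {z y : X} (hy : y ∈ generator C V z) {s : ℝ} (hs : 0 ≤ s) :
    HasDerivOnHalfLine K P (fun r => V r z) (V s y) s := by
  have h := (mem_generator_iff_integral hV hb).1 hy
  refine ((hV.isLocallyBoundedCurve hb y).hasDerivOnHalfLine hs).congr' ?_
  filter_upwards [self_mem_nhdsWithin] with r hr
  have hr0 : 0 ≤ r := hr.1
  have h1 := h r hr0
  have h2 := h s hs
  rw [semigroupIntegral_apply] at h1 h2
  simp only [h1, h2, sub_sub_sub_cancel_right]

theorem isClosed_graph_generator (hV : IsCSemigroup C V) (hb : LocallyASBounded V)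
    : IsClosed (generator C V).graph := by
  have h : (generator C V).graph = ⋂ (s : ℝ) (hs : 0 ≤ s),
      {p : X × X | semigroupIntegral hV hb hs p.2 = V s p.1 - C p.1} := by
    ext p
    simp only [mem_iInter]
    exact mem_generator_iff_integral hV hb
  rw [h]
  refine isClosed_iInter fun s => isClosed_iInter fun hs => isClosed_eq ?_ ?_
  · exact (semigroupIntegral hV hb hs).continuous.comp continuous_snd
  · exact ((V s).continuous.comp continuous_fst).sub (C.continuous.comp continuous_fst)

theorem isModuleHom_generator (hV : IsCSemigroup C V) (hb : LocallyASBounded V)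
    : IsModuleHom K P (generator C V) := by
  let G : Submodule (L0 K P) (X × X) :=
    { carrier := (generator C V).graph
      add_mem' := fun {p q} hp hq => (mem_generator_iff_integral hV hb).2 fun s hs => by
        have h1 := (mem_generator_iff_integral hV hb).1 hp s hs
        have h2 := (mem_generator_iff_integral hV hb).1 hq s hs
        rw [Prod.fst_add, Prod.snd_add, map_add, h1, h2, map_add, map_add]
        abel
      zero_mem' := (mem_generator_iff_integral hV hb).2 fun s hs => by simp
      smul_mem' := fun ξ p hp => (mem_generator_iff_integral hV hb).2 fun s hs => by
        have h1 := (mem_generator_iff_integral hV hb).1 hp s hs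
        rw [Prod.smul_fst, Prod.smul_snd, map_smul, h1, map_smul, map_smul, smul_sub] }
  refine ⟨G.toLinearPMap, ?_⟩
  rw [Submodule.toLinearPMap_graph_eq]
  · rfl
  · rintro ⟨x, y⟩ hp (hx : x = 0)
    have h1 : y ∈ generator C V x := hp
    rw [hx] at h1
    have h2 : (0 : X) ∈ generator C V 0 := G.zero_mem
    exact Part.mem_unique h1 h2

theorem range_subset_closure_dom (hV : IsCSemigroup C V) (hb : LocallyASBounded V)
    : range C ⊆ closure (generator C V).Dom := by
  rintro _ ⟨z, rfl⟩
  have h1 := tendsto_rsmul_integral (hV.isLocallyBoundedCurve hb z)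
  rw [hV.map_zero] at h1
  refine mem_closure_of_tendsto h1 ?_
  filter_upwards [self_mem_nhdsWithin] with s hs
  have hs : 0 < s := hs
  -- Moving the factor `1 / s` into the vector puts the mean itself in `D(A)`.
  have h2 := sub_mem_generator_semigroupIntegral hV hb hs.le (L0.realConst K P s⁻¹ • z)
  rw [map_smul] at h2
  exact (Part.dom_iff_mem).2 ⟨_, h2⟩

theorem cInv_comp_generator_comp (hV : IsCSemigroup C V) (hb : LocallyASBounded V) :
    (cInv C).comp ((generator C V).comp (PFun.lift fun z => C z)) = generator C V := by
  apply PFun.ext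
  intro x y
  have h : y ∈ (cInv C).comp ((generator C V).comp (PFun.lift fun z => C z)) x ↔
      C y ∈ generator C V (C x) := by
    refine Part.mem_bind_iff.trans ⟨?_, fun h => ⟨C y, ?_, hV.mem_cInv.2 rfl⟩⟩
    · rintro ⟨w, hw, hy⟩
      obtain ⟨v, hv, hw⟩ := Part.mem_bind_iff.1 hw
      have hv : v = C x := Part.mem_some_iff.1 hv
      rwa [hV.mem_cInv.1 hy, ← hv]
    · exact Part.mem_bind_iff.2 ⟨C x, Part.mem_some _, h⟩
  rw [h, mem_generator_iff_integral hV hb, mem_generator_iff_integral hV hb]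
  refine forall₂_congr fun s hs => ?_
  -- The integrated equation for the pair `(C x, C y)` is `C` applied to the one for `(x, y)`.
  rw [semigroupIntegral_comm_C, hV.comm_C hs, ← map_sub]
  exact hV.injective.eq_iff

end Semigroup

end RNModule

theorem theorem4p4 {Ω : Type*} {mΩ : MeasurableSpace Ω} {K : Type*} [RCLike K]
    (P : Measure Ω) [IsProbabilityMeasure P]
    {X : Type*} [AddCommGroup X] [Module (L0 K P) X] [RNModule K P X] [CompleteSpace X]
    (C : X →L[L0 K P] X) (V : ℝ → X →L[L0 K P] X)
    (hV : RNModule.IsCSemigroup C V) (hb : RNModule.LocallyASBounded V) :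
    -- all the integrals below exist
    (∀ z : X, ∀ s : ℝ, 0 ≤ s → RNModule.RiemannIntegrable K P (fun u => V u z) 0 s) ∧
    (∀ z : X, Tendsto
      (fun s : ℝ => RNModule.rsmul K P s⁻¹ (RNModule.riemannIntegral K P (fun u => V u z) 0 s))
      (𝓝[>] 0) (𝓝 (C z))) ∧
    (∀ z : X, ∀ s : ℝ, 0 ≤ s →
      ∃ h : RNModule.riemannIntegral K P (fun u => V u z) 0 s ∈ (RNModule.generator C V).Dom,
        (RNModule.generator C V).fn (RNModule.riemannIntegral K P (fun u => V u z) 0 s) h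
          = V s z - C z) ∧
    range C ⊆ closure (RNModule.generator C V).Dom ∧
    (∀ (z : X) (hz : z ∈ (RNModule.generator C V).Dom) (s : ℝ), 0 ≤ s →
      RNModule.HasDerivOnHalfLine K P (fun r => V r z) (V s ((RNModule.generator C V).fn z hz)) s ∧
      ∃ h : V s z ∈ (RNModule.generator C V).Dom,
        (RNModule.generator C V).fn (V s z) h = V s ((RNModule.generator C V).fn z hz)) ∧
    (∀ (z : X) (hz : z ∈ (RNModule.generator C V).Dom) (s : ℝ), 0 ≤ s →
      RNModule.riemannIntegral K P (fun u => V u ((RNModule.generator C V).fn z hz)) 0 s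
        = V s z - C z) ∧
    RNModule.IsModuleHom K P (RNModule.generator C V) ∧
    IsClosed (RNModule.generator C V).graph ∧
    (RNModule.cInv C).comp ((RNModule.generator C V).comp (PFun.lift fun z => C z))
      = RNModule.generator C V := by
  refine ⟨?_, ?_, ?_, RNModule.range_subset_closure_dom hV hb, ?_, ?_,
    RNModule.isModuleHom_generator hV hb, RNModule.isClosed_graph_generator hV hb,
    RNModule.cInv_comp_generator_comp hV hb⟩
  · exact fun z s hs => ⟨_, RNModule.hasRiemannIntegral_semigroup hV hb hs z⟩
  · intro z
    have h := RNModule.tendsto_rsmul_integral (hV.isLocallyBoundedCurve hb z)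
    rwa [hV.map_zero] at h
  · intro z s hs
    exact RNModule.sub_mem_generator_semigroupIntegral hV hb hs z
  · intro z hz s hs
    have h : (RNModule.generator C V).fn z hz ∈ RNModule.generator C V z := Part.get_mem hz
    exact ⟨RNModule.hasDerivOnHalfLine_semigroup hV hb h hs,
      hV.map_mem_generator h hs⟩
  · intro z hz s hs
    exact (RNModule.mem_generator_iff_integral hV hb).1 (Part.get_mem hz) s hs
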